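/- Let $\ell \ge 1$ and let $\Phi$ be a (reduced, crystallographic) root system of type $A_\ell$ in a Euclidean space $E$, with simple roots $\alpha_1,\dots,\alpha_\ell$ numbered consecutively along the Dynkin diagram and Weyl group $W$. Let $Z=\{x\in E : (\alpha,x)\in\mathbb{Z} \text{ for all } \alpha\in\Phi\}$ be the coweight lattice. For an integer $q>0$ put $$M(\Phi;q)=\{x+qZ\in Z/qZ : (\beta,x)\not\equiv 0 \pmod q \text{ for all } \beta\in\Phi\},$$ on which $W$ acts by $w(x+qZ)=w(x)+qZ$, and let $\chi_{\Phi,q}$ be the permutation character of $W$ on $M(\Phi;q)$. Let $w_0$ be the longest element of $W$ and, for $1\le j\le \ell$, let $w_j$ be the longest element of the subgroup of $W$ generated by the simple reflections $s_{\alpha_i}$, $i\ne j$. Put $\omega_0=1$ and $\omega_j=w_jw_0$ for $1\le j\le\ell$. Let $j\in\{0,\dots,\ell\}$, let $\omega=\omega_j$, let $g=\gcd(\ell+1,j)$ (so $g=\ell+1$ for $j=0$), and let $d$ be the order of $\omega$. Then for every integer $q>0$ $$\chi_{\Phi,q}(\omega)=\begin{cases}0 & \text{if } d\nmid q,\\ \varphi(d)\,(q-d)(q-2d)\cdots(q-d(g-1))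 & \text{if } d\mid q,\end{cases}$$ where $\varphi$ is Euler's totient function and the product over $k=1,\dots,g-1$ is $1$ when $g=1$. -/

import Mathlib

noncomputable section

namespace EquivariantQuasi

variable {ι M N : Type*} [AddCommGroup M] [Module ℝ M] [AddCommGroup N] [Module ℝ N]

/-- The action of the Weyl group on the space `N` in which coroots and coweights live. The group
`P.weylGroup` acts on `M` by `Equiv.weightEquiv` and `Equiv.coweightEquiv P P w` is the transpose of
`w`, so `w` acts on `N` as the transpose of `w⁻¹`; thus `⟨w • m, w • x⟩ = ⟨m, x⟩`
(see `root'_coweightAct`), and the reflection in a root acts by `P.coreflection`. -/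
def coweightAct (P : RootPairing ι ℝ M N) (w : P.weylGroup) : N ≃ₗ[ℝ] N :=
  RootPairing.Equiv.coweightEquiv P P (w : P.Aut)⁻¹

theorem coweightAct_one (P : RootPairing ι ℝ M N) (x : N) :
    coweightAct P 1 x = x := by
  simp [coweightAct]

theorem coweightAct_mul (P : RootPairing ι ℝ M N) (v w : P.weylGroup) (x : N) :
    coweightAct P (v * w) x = coweightAct P v (coweightAct P w x) := by
  simp [coweightAct]

theorem coweightAct_ofIdx (P : RootPairing ι ℝ M N) (i : ι) (x : N) :
    coweightAct P (RootPairing.weylGroup.ofIdx P i) x = P.coreflection i x := by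
  simp [coweightAct, RootPairing.weylGroup.ofIdx]

theorem root'_coweightAct (P : RootPairing ι ℝ M N) (w : P.weylGroup) (i : ι) (x : N) :
    P.root' i (coweightAct P w x) = P.root' (P.weylGroupToPerm w⁻¹ i) x := by
  have h := RootPairing.Hom.weight_coweight_transpose_apply P P x ((w : P.Aut)⁻¹).toHom
  have h2 := LinearMap.congr_fun h (P.root i)
  have h3 := RootPairing.Hom.root_weightMap_apply P P i ((w : P.Aut)⁻¹).toHom
  simp only [LinearMap.dualMap_apply, h3] at h2
  exact h2.symm

/-- The coweight lattice `Z`: the points at which every root takes an integral value. -/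
def coweightLattice (P : RootPairing ι ℝ M N) : AddSubgroup N where
  carrier := {x | ∀ i, ∃ k : ℤ, P.root' i x = k}
  zero_mem' := fun i => ⟨0, by simp⟩
  add_mem' := fun {x y} hx hy i => by
    obtain ⟨k, hk⟩ := hx i
    obtain ⟨l, hl⟩ := hy i
    exact ⟨k + l, by rw [map_add, hk, hl, Int.cast_add]⟩
  neg_mem' := fun {x} hx i => by
    obtain ⟨k, hk⟩ := hx i
    exact ⟨-k, by rw [map_neg, hk, Int.cast_neg]⟩

/-- The action of a Weyl group element on the coweight lattice. -/
def latticeAct (P : RootPairing ι ℝ M N) (w : P.weylGroup) :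
    coweightLattice P →+ coweightLattice P where
  toFun x := ⟨coweightAct P w x, fun i => by rw [root'_coweightAct]; exact x.2 _⟩
  map_zero' := by ext; simp
  map_add' x y := by ext; simp

/-- The subgroup `qZ` of the coweight lattice. -/
def multiples (P : RootPairing ι ℝ M N) (q : ℕ) : AddSubgroup (coweightLattice P) :=
  (nsmulAddMonoidHom q).range

/-- The finite group `Z / qZ`. -/
abbrev LatticeMod (P : RootPairing ι ℝ M N) (q : ℕ) : Type _ :=
  coweightLattice P ⧸ multiples P q

/-- The induced action of a Weyl group element on `Z / qZ`. -/
def modAct (P : RootPairing ι ℝ M N) (q : ℕ) (w : P.weylGroup) :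
    LatticeMod P q →+ LatticeMod P q :=
  QuotientAddGroup.map _ _ (latticeAct P w) (by
    rintro _ ⟨x, rfl⟩
    exact ⟨latticeAct P w x, by simp⟩)

/-- The complement `M(Φ; q)` of the Coxeter arrangement modulo `q`: the classes in `Z / qZ` of the
`x` such that `⟨β, x⟩ ≢ 0 (mod q)` for every root `β`. (The conditions for `β` and `-β` agree, so
`β` may equally range over the positive roots, and they depend only on the class of `x`.) -/
def complement (P : RootPairing ι ℝ M N) (q : ℕ) : Set (LatticeMod P q) :=
  {t | ∃ x : coweightLattice P, (QuotientAddGroup.mk x : LatticeMod P q) = t ∧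
    ∀ i, ¬ ∃ k : ℤ, P.root' i (x : N) = q * k}

theorem modAct_mem (P : RootPairing ι ℝ M N) (q : ℕ) (w : P.weylGroup) {t : LatticeMod P q}
    (ht : t ∈ complement P q) : modAct P q w t ∈ complement P q := by
  obtain ⟨x, rfl, hx⟩ := ht
  refine ⟨latticeAct P w x, rfl, fun i => ?_⟩
  have h : P.root' i (latticeAct P w x : N) = P.root' (P.weylGroupToPerm w⁻¹ i) x :=
    root'_coweightAct P w i x
  rw [h]
  exact hx _

/-- The action of the Weyl group on `M(Φ; q)`. -/
instance complementAction (P : RootPairing ι ℝ M N) (q : ℕ) :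
    MulAction P.weylGroup (complement P q) where
  smul w t := ⟨modAct P q w t, modAct_mem P q w t.2⟩
  one_smul := by
    rintro ⟨t, x, rfl, hx⟩
    refine Subtype.ext ?_
    change (QuotientAddGroup.mk (latticeAct P 1 x) : LatticeMod P q) = _
    congr 1
    exact Subtype.ext (coweightAct_one P x)
  mul_smul := by
    rintro v w ⟨t, x, rfl, hx⟩
    refine Subtype.ext ?_
    change (QuotientAddGroup.mk (latticeAct P (v * w) x) : LatticeMod P q) =
      QuotientAddGroup.mk (latticeAct P v (latticeAct P w x))
    congr 1
    exact Subtype.ext (coweightAct_mul P v w x)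

/-- The equivariant characteristic quasi-polynomial `χ_{Φ,q}`: the character of the permutation
representation of the Weyl group on `M(Φ; q)`. -/
def equivChar (P : RootPairing ι ℝ M N) (q : ℕ) (w : P.weylGroup) : ℂ :=
  (Representation.ofMulAction ℂ P.weylGroup (complement P q)).character w

/-- The subgroup of the Weyl group generated by the reflections in the roots indexed by `S`. -/
def reflSubgroup (P : RootPairing ι ℝ M N) (S : Set ι) : Subgroup P.weylGroup :=
  Subgroup.closure (RootPairing.weylGroup.ofIdx P '' S)

/-- The length of `w` with respect to the reflections in the roots indexed by `S`: the least number
of factors in an expression of `w` as a product of such reflections. -/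
def reflLength (P : RootPairing ι ℝ M N) (S : Set ι) (w : P.weylGroup) : ℕ :=
  sInf {n | ∃ l : List ι, (∀ i ∈ l, i ∈ S) ∧ l.length = n ∧
    (l.map (RootPairing.weylGroup.ofIdx P)).prod = w}

/-- `w` is an element of maximal length of the group generated by the reflections in `S`. -/
def IsLongest (P : RootPairing ι ℝ M N) (S : Set ι) (w : P.weylGroup) : Prop :=
  w ∈ reflSubgroup P S ∧ ∀ v ∈ reflSubgroup P S, reflLength P S v ≤ reflLength P S w

theorem finite_weylGroup [Finite ι] (P : RootPairing ι ℝ M N) [P.IsRootSystem] :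
    Finite P.weylGroup := by
  refine Finite.of_injective (fun w : P.weylGroup => P.weylGroupToPerm w) fun v w h => ?_
  refine Subtype.ext (RootPairing.Equiv.weightHom_injective P ?_)
  refine LinearEquiv.toLinearMap_injective ?_
  refine LinearMap.ext_on_range (v := P.root) (RootPairing.IsRootSystem.span_root_eq_top) fun i => ?_
  have hv := P.weylGroup_apply_root v i
  have hw := P.weylGroup_apply_root w i
  have h' : P.weylGroupToPerm v = P.weylGroupToPerm w := h
  rw [h', ← hw] at hv
  exact hv

theorem exists_isLongest [Finite ι] (P : RootPairing ι ℝ M N) [P.IsRootSystem] (S : Set ι) :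
    ∃ w, IsLongest P S w := by
  have := finite_weylGroup P
  obtain ⟨w, hw⟩ := Finite.exists_max fun v : reflSubgroup P S => reflLength P S (v : P.weylGroup)
  exact ⟨w, w.2, fun v hv => hw ⟨v, hv⟩⟩

/-- The longest element of the group generated by the reflections in `S` (which is unique when `S`
consists of simple roots). -/
def longest [Finite ι] (P : RootPairing ι ℝ M N) [P.IsRootSystem] (S : Set ι) : P.weylGroup :=
  (exists_isLongest P S).choose

/-- The elements `ω_0 = 1` and `ω_j = w_j w_0` for `1 ≤ j ≤ ℓ`, where `w_0` is the longest element
of the Weyl group and `w_j` that of the group generated by the simple reflections other than the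
`j`-th one. The simple roots are `α_j = P.root (e (j - 1))`, numbered by `e`. -/
def omega [Finite ι] {P : RootPairing ι ℝ M N} [P.IsRootSystem] (b : P.Base) {l : ℕ}
    (e : Fin l ≃ b.support) : Fin (l + 1) → P.weylGroup :=
  Fin.cases 1 fun i =>
    longest P ((b.support : Set ι) \ {(e i : ι)}) * longest P (b.support : Set ι)

/-- The base `b` is of type `A_l`, with its simple roots numbered by `e` along the Dynkin diagram. -/
def IsTypeA {P : RootPairing ι ℝ M N} [P.IsCrystallographic] (b : P.Base) {l : ℕ}
    (e : Fin l ≃ b.support) : Prop :=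
  b.cartanMatrix.submatrix e e = CartanMatrix.A l

end EquivariantQuasi

end

/-!
The Weyl group of type `A_l` permutes coordinates indexed by `Fin (l + 1)`, which we treat as the
cyclic group `ℤ / (l + 1)`. The permutations generated by the adjacent transpositions other than
`(m - 1, m)` are those that stabilize `{0, …, m - 1}`, and the longest of them reverses the blocks
`{0, …, m - 1}` and `{m, …, l}`: it is `i ↦ m - 1 - i`. Hence `ω_j`, the product of two such
reversals, is the translation `i ↦ i + j`, whose order `d` is the additive order of `j`.

An element of `Z / qZ` together with a common shift in `ℤ / q` is a function
`F : ℤ / (l + 1) → ℤ / q`. It lies over the complement if and only if `F` is injective, and over a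
fixed point of `ω_j` if and only if `F (i + j) = F i + c` for some `c`. Injectivity forces `c` to
have order `d` as well, which leaves `φ(d)` choices if `d ∣ q` and none otherwise. Given `c`, such
an `F` is determined by its values on representatives of the `g` cosets of `⟨j⟩`, which have to lie
in different cosets of `⟨c⟩`: there are `d ^ g * (q / d) (q / d - 1) ⋯ (q / d - g + 1)`
possibilities. The common shift accounts for the remaining factor `q`.
-/

noncomputable section

namespace EquivariantQuasi

open Equiv MulAction
open scoped Pointwise

theorem character_ofMulAction {k G X : Type*} [Field k] [Group G] [MulAction G X] [Finite X]
    (g : G) : (Representation.ofMulAction k G X).character g = Nat.card {x : X // g • x = x} := by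
  classical
  have := Fintype.ofFinite X
  rw [Representation.character, LinearMap.trace_eq_matrix_trace k (MonoidAlgebra.basis X k),
    Matrix.trace, Nat.card_eq_fintype_card, Fintype.card_subtype, ← Finset.sum_boole]
  refine Finset.sum_congr rfl fun x _ => ?_
  rw [Matrix.diag_apply, LinearMap.toMatrix_apply, MonoidAlgebra.basis_apply,
    Representation.ofMulAction_single]
  exact Finsupp.single_apply

section Permutations

/-- The inversions of a permutation, as pairs of positions. -/
def inversions {α : Type*} [LinearOrder α] [Fintype α] (σ : Perm α) : Finset (α × α) :=
  {p | p.1 < p.2 ∧ σ p.2 < σ p.1}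

theorem inversions_one {α : Type*} [LinearOrder α] [Fintype α] :
    inversions (1 : Perm α) = ∅ := by
  exact Finset.filter_eq_empty_iff.2 fun _ _ h => h.1.not_gt h.2

theorem swap_apply_lt_swap_apply_iff {α : Type*} [LinearOrder α] {a b x y : α} (h : a ⋖ b)
    (hab : ¬(x = a ∧ y = b)) (hba : ¬(x = b ∧ y = a)) : swap a b x < swap a b y ↔ x < y := by
  have hlt : a < b := h.lt
  have hb : ∀ z, z < b ↔ z ≤ a := fun z => h.lt_iff_le_left
  have ha : ∀ z, a < z ↔ b ≤ z := fun z => h.lt_iff_le_right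
  grind

theorem perm_eq_one_of_strictMono {α : Type*} [LinearOrder α] [WellFoundedLT α] {σ : Perm α}
    (hσ : StrictMono σ) : σ = 1 := by
  ext i
  exact DFunLike.congr_fun
    (Subsingleton.elim (hσ.orderIsoOfSurjective σ σ.surjective) (OrderIso.refl α)) i

section Inversions

variable {α : Type*} [LinearOrder α] [Fintype α] {σ : Perm α} {a b : α}

theorem card_inversions_mul_swap_of_lt (h : a ⋖ b) (hσ : σ a < σ b) :
    (inversions (σ * swap a b)).card = (inversions σ).card + 1 := by
  have hmap : (inversions (σ * swap a b)).map ((swap a b).prodCongr (swap a b)).toEmbedding =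
      insert (b, a) (inversions σ) := by
    ext ⟨x, y⟩
    have hxy := @swap_apply_lt_swap_apply_iff α _ a b x y h
    have hlt := h.lt
    simp only [Finset.mem_map_equiv, Finset.mem_insert, inversions, Finset.mem_filter_univ,
      prodCongr_symm, symm_swap, prodCongr_apply, Prod.map, Perm.mul_apply, Prod.mk.injEq]
    grind
  rw [← Finset.card_map, hmap, Finset.card_insert_of_notMem]
  simp [inversions, h.lt.le]

theorem card_inversions_mul_swap_of_gt (h : a ⋖ b) (hσ : σ b < σ a) :
    (inversions (σ * swap a b)).card + 1 = (inversions σ).card := by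
  rw [← card_inversions_mul_swap_of_lt h (by simpa using hσ), mul_swap_mul_self]

theorem card_inversions_mul_swap_le (h : a ⋖ b) :
    (inversions (σ * swap a b)).card ≤ (inversions σ).card + 1 := by
  rcases (σ.injective.ne h.ne).lt_or_gt with hσ | hσ
  · exact (card_inversions_mul_swap_of_lt h hσ).le
  · have := card_inversions_mul_swap_of_gt h hσ
    omega

end Inversions

variable {n : ℕ}

theorem castSucc_covBy_succ (k : Fin n) : k.castSucc ⋖ k.succ :=
  ⟨Fin.castSucc_lt_succ, fun _ h h' => (Fin.castSucc_lt_iff_succ_le.1 h).not_gt h'⟩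

/-- The adjacent transposition exchanging `k` and `k + 1`. -/
def adjSwap (k : Fin n) : Perm (Fin (n + 1)) := swap k.castSucc k.succ

theorem card_inversions_list_prod_le (L : List (Fin n)) :
    (inversions (L.map adjSwap).prod).card ≤ L.length := by
  induction L using List.reverseRecOn with
  | nil => simp [inversions_one]
  | append_singleton L k ih =>
    simpa [adjSwap] using (card_inversions_mul_swap_le (castSucc_covBy_succ k)).trans
      (Nat.add_le_add_right ih 1)

variable {m : Fin (n + 1)} {σ : Perm (Fin (n + 1))}

theorem adjSwap_mem_stabilizer_Iio {k : Fin n} (hk : k.succ ≠ m) :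
    adjSwap k ∈ stabilizer (Perm (Fin (n + 1))) (Set.Iio m) := by
  rw [adjSwap, swap_mem_stabilizer, Set.mem_Iio, Set.mem_Iio, Fin.castSucc_lt_iff_succ_le]
  exact hk.le_iff_lt

theorem eq_one_of_mem_stabilizer_Iio (hσ : σ ∈ stabilizer (Perm (Fin (n + 1))) (Set.Iio m))
    (h : ∀ k : Fin n, k.succ ≠ m → σ k.castSucc < σ k.succ) : σ = 1 := by
  refine perm_eq_one_of_strictMono (Fin.strictMono_iff_lt_succ.2 fun k => ?_)
  by_cases hk : k.succ = m
  · have hmem := mem_stabilizer_set.1 hσ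
    exact ((hmem k.castSucc).2 (hk ▸ Fin.castSucc_lt_succ)).trans_le
      (not_lt.1 fun hlt => hk.not_lt ((hmem k.succ).1 hlt))
  · exact h k hk

theorem subLeft_mem_stabilizer_Iio :
    Equiv.subLeft (m - 1) ∈ stabilizer (Perm (Fin (n + 1))) (Set.Iio m) := by
  refine mem_stabilizer_set.2 fun i => ?_
  cases m using Fin.cases with
  | zero => simp
  | succ k =>
    have hk : k.succ - 1 = k.castSucc := by
      rw [← Fin.coeSucc_eq_succ, add_sub_cancel_right]
    simp only [Perm.smul_def, subLeft_apply, hk, Set.mem_Iio, ← Fin.le_castSucc_iff,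
      Fin.sub_le_iff]

theorem eq_subLeft_of_mem_stabilizer_Iio
    (hσ : σ ∈ stabilizer (Perm (Fin (n + 1))) (Set.Iio m))
    (h : ∀ k : Fin n, k.succ ≠ m → σ k.succ < σ k.castSucc) : σ = Equiv.subLeft (m - 1) := by
  suffices hone : σ * Equiv.subLeft (m - 1) = 1 by
    rw [mul_eq_one_iff_eq_inv.1 hone, inv_eq_iff_mul_eq_one]
    ext; simp
  refine eq_one_of_mem_stabilizer_Iio (mul_mem hσ subLeft_mem_stabilizer_Iio) fun k hk => ?_
  obtain ⟨c, hc⟩ : ∃ c : Fin n, c.castSucc = m - 1 - k.succ := by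
    refine Fin.exists_castSucc_eq.2 fun hlast => hk (sub_eq_zero.1 ?_).symm
    rw [← Fin.last_add_one, ← hlast, sub_right_comm, sub_add_cancel]
  have hc' : c.succ = m - 1 - k.castSucc := by
    rw [← Fin.coeSucc_eq_succ, hc, ← Fin.coeSucc_eq_succ, sub_add_eq_sub_sub, sub_add_cancel]
  simp only [Perm.mul_apply, subLeft_apply, ← hc, ← hc']
  refine h c fun hcm => Fin.succ_ne_zero k ?_
  rw [hcm, sub_sub, add_comm 1, Fin.coeSucc_eq_succ, eq_comm, sub_eq_self] at hc'
  exact hc'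

theorem exists_list_adjSwap_prod {σ : Perm (Fin (n + 1))}
    (hσ : σ ∈ stabilizer (Perm (Fin (n + 1))) (Set.Iio m)) :
    ∃ L : List (Fin n), (∀ k ∈ L, k.succ ≠ m) ∧ L.length = (inversions σ).card ∧
      (L.map adjSwap).prod = σ := by
  by_cases hdesc : ∃ k : Fin n, k.succ ≠ m ∧ σ k.succ < σ k.castSucc
  · obtain ⟨k, hkm, hk⟩ := hdesc
    have hcard := card_inversions_mul_swap_of_gt (castSucc_covBy_succ k) hk
    obtain ⟨L, hL, hlen, hprod⟩ :=
      exists_list_adjSwap_prod (mul_mem hσ (adjSwap_mem_stabilizer_Iio hkm))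
    refine ⟨L ++ [k], ?_, by rw [← hcard, List.length_append, hlen, adjSwap]; rfl, ?_⟩
    · simpa [or_imp, forall_and] using ⟨hL, hkm⟩
    · simp [hprod, adjSwap]
  · push Not at hdesc
    obtain rfl := eq_one_of_mem_stabilizer_Iio hσ fun k hk =>
      (hdesc k hk).lt_of_ne (σ.injective.ne Fin.castSucc_lt_succ.ne)
    exact ⟨[], by simp, by simp [inversions_one], rfl⟩
termination_by (inversions σ).card
decreasing_by exact Nat.lt_of_succ_le hcard.le

end Permutations

section ShiftMaps

open AddSubgroup
open scoped AddConstMap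

variable {G H : Type*} [AddCommGroup G] [AddCommGroup H] {j : G} {c : H}

theorem orderOf_addRight (j : G) : orderOf (Equiv.addRight j) = addOrderOf j := by
  have h : (AddAction.toPermHom G G j).toMul = Equiv.addRight j := Equiv.ext fun i => add_comm j i
  rw [← h]
  exact addOrderOf_injective (AddAction.toPermHom G G) AddAction.toPerm_injective j

theorem zsmul_eq_zsmul_of_addOrderOf_dvd (h : addOrderOf c ∣ addOrderOf j) {k k' : ℤ}
    (hk : k • j = k' • j) : k • c = k' • c :=
  zsmul_eq_zsmul_iff_modEq.2 ((zsmul_eq_zsmul_iff_modEq.1 hk).of_dvd (Int.natCast_dvd_natCast.2 h))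

theorem addOrderOf_eq_of_injective {F : G →+c[j, c] H} (hF : Function.Injective F) :
    addOrderOf c = addOrderOf j := by
  refine addOrderOf_eq_addOrderOf_iff.2 fun n => ?_
  rw [← hF.eq_iff, AddConstMapClass.map_nsmul_const, add_eq_left]

theorem exists_eq_out_add_zsmul (j i : G) : ∃ k : ℤ, i = (i : G ⧸ zmultiples j).out + k • j := by
  obtain ⟨⟨_, k, rfl⟩, hk⟩ := QuotientAddGroup.mk_out_eq_add (zmultiples j) i
  exact ⟨-k, by rw [hk]; simp⟩

theorem mk_add_zsmul (i j : G) (k : ℤ) : ((i + k • j : G) : G ⧸ zmultiples j) = i :=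
  QuotientAddGroup.mk_add_of_mem _ (zsmul_mem_zmultiples j k)

theorem injective_iff_injective_mk_out (hd : addOrderOf c = addOrderOf j) (F : G →+c[j, c] H) :
    Function.Injective F ↔
      Function.Injective fun o : G ⧸ zmultiples j => (F o.out : H ⧸ zmultiples c) := by
  constructor
  · intro hF o o' h
    obtain ⟨k, hk : k • c = _⟩ := QuotientAddGroup.eq.1 h
    have hout : o.out + k • j = o'.out := hF <| by
      rw [AddConstMapClass.map_add_zsmul, hk, add_neg_cancel_left]
    rw [← QuotientAddGroup.out_eq' o, ← QuotientAddGroup.out_eq' o', ← hout, mk_add_zsmul]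
  · intro hF i i' h
    obtain ⟨k, hk⟩ := exists_eq_out_add_zsmul j i
    obtain ⟨k', hk'⟩ := exists_eq_out_add_zsmul j i'
    rw [hk, hk', AddConstMapClass.map_add_zsmul, AddConstMapClass.map_add_zsmul] at h
    have hmk := congrArg (QuotientAddGroup.mk (s := zmultiples c)) h
    rw [mk_add_zsmul, mk_add_zsmul] at hmk
    rw [hF hmk, add_right_inj] at h
    rw [hk, hk', hF hmk, zsmul_eq_zsmul_of_addOrderOf_dvd hd.symm.dvd h]

theorem exists_addConstMap_out_eq (h : addOrderOf c ∣ addOrderOf j) (y : G ⧸ zmultiples j → H) :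
    ∃ F : G →+c[j, c] H, ∀ o : G ⧸ zmultiples j, F o.out = y o := by
  choose κ hκ using exists_eq_out_add_zsmul j
  have hκ_eq : ∀ (i : G) (k : ℤ), i = (i : G ⧸ zmultiples j).out + k • j → κ i • c = k • c :=
    fun i k hk => zsmul_eq_zsmul_of_addOrderOf_dvd h (add_left_cancel ((hκ i).symm.trans hk))
  have hmk : ∀ i, ((i + j : G) : G ⧸ zmultiples j) = i := fun i => by simp
  refine ⟨⟨fun i => y i + κ i • c, fun i => ?_⟩, fun o => ?_⟩
  · have hstep : κ (i + j) • c = (κ i + 1) • c := hκ_eq _ _ <| by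
      rw [hmk, add_zsmul, one_zsmul, ← add_assoc, ← hκ]
    rw [hmk, hstep, add_zsmul, one_zsmul, add_assoc]
  · have hzero : κ o.out • c = (0 : ℤ) • c := hκ_eq _ _ <| by simp
    simp [hzero]

/-- A map intertwining translations by `j` and `c` amounts to a choice of its values on
representatives of the cosets of `j`. -/
def addConstMapEquiv (h : addOrderOf c ∣ addOrderOf j) :
    (G →+c[j, c] H) ≃ (G ⧸ zmultiples j → H) :=
  Equiv.ofBijective (fun F o => F o.out) <| by
    refine ⟨fun F F' hFF' => AddConstMap.ext fun i => ?_, fun y => ?_⟩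
    · obtain ⟨k, hk⟩ := exists_eq_out_add_zsmul j i
      have hout : F (i : G ⧸ zmultiples j).out = F' (i : G ⧸ zmultiples j).out := congrFun hFF' i
      rw [hk, AddConstMapClass.map_add_zsmul, AddConstMapClass.map_add_zsmul, hout]
    · obtain ⟨F, hF⟩ := exists_addConstMap_out_eq h y
      exact ⟨F, funext hF⟩

/-- Lifting an injection into `H ⧸ C` to `H` amounts to choosing an element of `C` for each
point. -/
def injectiveMkEquiv (C : AddSubgroup H) (Q : Type*) :
    {y : Q → H // Function.Injective fun o => (y o : H ⧸ C)} ≃ (Q ↪ H ⧸ C) × (Q → C) :=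
  ((((Equiv.refl Q).arrowCongr addGroupEquivQuotientProdAddSubgroup).trans
    (Equiv.arrowProdEquivProdArrow Q (fun _ => H ⧸ C) fun _ => C)).subtypeEquiv
      (q := fun p => Function.Injective p.1) fun _ => Iff.rfl).trans <|
    Equiv.prodSubtypeFstEquivSubtypeProd.trans <|
      (Equiv.subtypeInjectiveEquivEmbedding Q (H ⧸ C)).prodCongr (Equiv.refl _)

theorem card_injective_mk [Finite H] (C : AddSubgroup H) (Q : Type*) [Finite Q] :
    Nat.card {y : Q → H // Function.Injective fun o => (y o : H ⧸ C)} =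
      (Nat.card (H ⧸ C)).descFactorial (Nat.card Q) * Nat.card C ^ Nat.card Q := by
  classical
  have := Fintype.ofFinite Q
  have := Fintype.ofFinite (H ⧸ C)
  rw [Nat.card_congr (injectiveMkEquiv C Q), Nat.card_prod, Nat.card_fun,
    Nat.card_eq_fintype_card (α := Q ↪ H ⧸ C), Fintype.card_embedding_eq,
    Nat.card_eq_fintype_card (α := H ⧸ C), Nat.card_eq_fintype_card (α := Q)]

theorem card_quotient_zmultiples [Finite G] (a : G) :
    Nat.card (G ⧸ zmultiples a) = Nat.card G / addOrderOf a := by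
  rw [AddSubgroup.card_eq_card_quotient_mul_card_addSubgroup (zmultiples a),
    Nat.card_zmultiples, Nat.mul_div_cancel _ (addOrderOf_pos a)]

theorem card_injective_addConstMap [Finite G] [Finite H] (j : G) (c : H) :
    Nat.card {F : G →+c[j, c] H // Function.Injective F} =
      if addOrderOf c = addOrderOf j then
        (Nat.card H / addOrderOf j).descFactorial (Nat.card G / addOrderOf j) *
          addOrderOf j ^ (Nat.card G / addOrderOf j)
      else 0 := by
  split_ifs with hd
  · rw [Nat.card_congr ((addConstMapEquiv hd.dvd).subtypeEquiv
        (q := fun y => Function.Injective fun o => (y o : H ⧸ zmultiples c))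
        (injective_iff_injective_mk_out hd)),
      card_injective_mk, card_quotient_zmultiples, card_quotient_zmultiples, Nat.card_zmultiples,
      hd]
  · have : IsEmpty {F : G →+c[j, c] H // Function.Injective F} :=
      ⟨fun F => hd (addOrderOf_eq_of_injective F.2)⟩
    exact Nat.card_of_isEmpty

/-- Sorting the maps that intertwine translation by `j` with some translation `c` according to
`c`. -/
def sigmaAddConstMapEquiv (j : G) :
    (Σ c : H, {F : G →+c[j, c] H // Function.Injective F}) ≃
      {F : G → H // Function.Injective F ∧ ∃ c, ∀ i, F (i + j) = F i + c} where
  toFun p := ⟨p.2.1, p.2.2, p.1, p.2.1.map_add_const'⟩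
  invFun F := ⟨F.1 j - F.1 0, ⟨F.1, fun i => by
    obtain ⟨c, hc⟩ := F.2.2
    have h0 := hc 0
    rw [zero_add] at h0
    rw [hc, h0, add_sub_cancel_left]⟩, F.2.1⟩
  left_inv := by
    rintro ⟨c, ⟨F, hFc⟩, hF⟩
    obtain rfl : F j - F 0 = c := by
      have h0 := hFc 0
      rw [zero_add] at h0
      rw [h0, add_sub_cancel_left]
    rfl
  right_inv F := rfl

theorem card_injective_intertwining_translation [Finite G] [Finite H] [IsAddCyclic H] (j : G) :
    Nat.card {F : G → H // Function.Injective F ∧ ∃ c, ∀ i, F (i + j) = F i + c} =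
      if addOrderOf j ∣ Nat.card H then
        Nat.totient (addOrderOf j) *
          ((Nat.card H / addOrderOf j).descFactorial (Nat.card G / addOrderOf j) *
            addOrderOf j ^ (Nat.card G / addOrderOf j))
      else 0 := by
  classical
  have := Fintype.ofFinite H
  have (c : H) : Finite {F : G →+c[j, c] H // Function.Injective F} :=
    .of_injective (fun F => (F.1 : G → H)) (DFunLike.coe_injective.comp Subtype.val_injective)
  rw [← Nat.card_congr (sigmaAddConstMapEquiv j), Nat.card_sigma]
  simp only [card_injective_addConstMap]
  rw [← Finset.sum_filter, Finset.sum_const, smul_eq_mul]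
  split_ifs with h
  · rw [IsAddCyclic.card_addOrderOf_eq_totient (by rwa [← Nat.card_eq_fintype_card])]
  · rw [Finset.card_eq_zero.2, zero_mul]
    exact Finset.filter_eq_empty_iff.2 fun c _ hc => h (hc ▸ addOrderOf_dvd_natCard c)

end ShiftMaps

section CoweightLattice

variable {ι M N : Type*} [AddCommGroup M] [Module ℝ M] [AddCommGroup N] [Module ℝ N]
  (P : RootPairing ι ℝ M N)

/-- The integral value of a root on the coweight lattice. -/
def integralRoot (i : ι) : coweightLattice P →+ ℤ where
  toFun x := (x.2 i).choose
  map_zero' := by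
    rw [← Int.cast_inj (α := ℝ), ← ((0 : coweightLattice P).2 i).choose_spec]
    simp
  map_add' x y := by
    rw [← Int.cast_inj (α := ℝ), ← ((x + y).2 i).choose_spec, Int.cast_add,
      ← (x.2 i).choose_spec, ← (y.2 i).choose_spec]
    exact map_add _ _ _

theorem intCast_integralRoot (i : ι) (x : coweightLattice P) :
    (integralRoot P i x : ℝ) = P.root' i (x : N) :=
  (x.2 i).choose_spec.symm

theorem latticeAct_one (x : coweightLattice P) : latticeAct P 1 x = x :=
  Subtype.ext (coweightAct_one P x)

theorem latticeAct_mul (v w : P.weylGroup) (x : coweightLattice P) :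
    latticeAct P (v * w) x = latticeAct P v (latticeAct P w x) :=
  Subtype.ext (coweightAct_mul P v w x)

theorem integralRoot_latticeAct (w : P.weylGroup) (i : ι) (x : coweightLattice P) :
    integralRoot P i (latticeAct P w x) = integralRoot P (P.weylGroupToPerm w⁻¹ i) x := by
  rw [← Int.cast_inj (α := ℝ), intCast_integralRoot, intCast_integralRoot]
  exact root'_coweightAct P w i x

theorem integralRoot_latticeAct_ofIdx [P.IsCrystallographic] (i j : ι) (x : coweightLattice P) :
    integralRoot P i (latticeAct P (RootPairing.weylGroup.ofIdx P j) x) =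
      integralRoot P i x - P.pairingIn ℤ i j * integralRoot P j x := by
  have hpair : (P.pairingIn ℤ i j : ℝ) = P.pairing i j := P.algebraMap_pairingIn ℤ i j
  have hact : (latticeAct P (RootPairing.weylGroup.ofIdx P j) x : N) = P.coreflection j x :=
    coweightAct_ofIdx P j x
  rw [← Int.cast_inj (α := ℝ), Int.cast_sub, Int.cast_mul, hpair]
  simp only [intCast_integralRoot, hact, RootPairing.coreflection_apply, map_sub, map_smul,
    RootPairing.root'_coroot_eq_pairing, smul_eq_mul, mul_comm]

theorem mk_mem_complement_iff {q : ℕ} {x : coweightLattice P} :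
    (QuotientAddGroup.mk x : LatticeMod P q) ∈ complement P q ↔
      ∀ i, ¬ (q : ℤ) ∣ integralRoot P i x := by
  have hdvd : ∀ i (y : coweightLattice P),
      (∃ k : ℤ, P.root' i (y : N) = q * k) ↔ (q : ℤ) ∣ integralRoot P i y := fun i y =>
    exists_congr fun k => by rw [← intCast_integralRoot]; norm_cast
  refine ⟨?_, fun h => ⟨x, rfl, fun i => (hdvd i x).not.2 (h i)⟩⟩
  rintro ⟨y, hyx, hy⟩ i hi
  obtain ⟨z, hz⟩ := QuotientAddGroup.eq.1 hyx
  refine hy i ((hdvd i y).2 ?_)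
  rw [eq_neg_add_iff_add_eq] at hz
  rw [← hz, map_add] at hi
  refine (dvd_add_left ?_).1 hi
  simp

theorem weylGroupToPerm_ofIdx (i : ι) :
    P.weylGroupToPerm (RootPairing.weylGroup.ofIdx P i) = P.reflectionPerm i :=
  RootPairing.Equiv.reflection_indexEquiv P i

theorem ofIdx_reflectionPerm (i j : ι) :
    RootPairing.weylGroup.ofIdx P (P.reflectionPerm j i) =
      RootPairing.weylGroup.ofIdx P j * RootPairing.weylGroup.ofIdx P i *
        RootPairing.weylGroup.ofIdx P j := by
  refine Subtype.ext (RootPairing.Equiv.weightHom_injective P ?_)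
  simp only [RootPairing.weylGroup.ofIdx, Subgroup.coe_mul, map_mul]
  simp [RootPairing.reflection_reflectionPerm]

variable {P} (b : P.Base)

section SimpleReflections

variable [Finite ι] [P.IsCrystallographic] [P.IsReduced]

theorem reflSubgroup_support : reflSubgroup P b.support = ⊤ := by
  have hrefl : ∀ i, RootPairing.weylGroup.ofIdx P i ∈ reflSubgroup P b.support := by
    have hsimple : ∀ i ∈ b.support, RootPairing.weylGroup.ofIdx P i ∈ reflSubgroup P b.support :=
      fun i hi => Subgroup.subset_closure ⟨i, hi, rfl⟩
    intro i
    induction i using b.induction_reflect with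
    | h₀ i hi => rw [ofIdx_reflectionPerm]; exact mul_mem (mul_mem hi hi) hi
    | h₁ i hi => exact hsimple i hi
    | h₂ i j hi hj =>
      rw [ofIdx_reflectionPerm]
      exact mul_mem (mul_mem (hsimple j hj) hi) (hsimple j hj)
  refine (Subgroup.eq_top_iff' _).2 fun ⟨w, hw⟩ => ?_
  induction hw using RootPairing.weylGroup.induction with
  | mem i => exact hrefl i
  | one => exact one_mem _
  | mul v w hv hw ihv ihw => exact mul_mem ihv ihw

theorem exists_weylGroupToPerm_simple_eq (i : ι) :
    ∃ w, ∃ j ∈ b.support, P.weylGroupToPerm w j = i := by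
  have hstep : ∀ i j, (∃ w, ∃ k ∈ b.support, P.weylGroupToPerm w k = i) →
      ∃ w, ∃ k ∈ b.support, P.weylGroupToPerm w k = P.reflectionPerm j i := by
    rintro _ j ⟨w, k, hk, rfl⟩
    exact ⟨RootPairing.weylGroup.ofIdx P j * w, k, hk, by
      rw [map_mul, weylGroupToPerm_ofIdx, Perm.mul_apply]⟩
  induction i using b.induction_reflect with
  | h₀ i hi => exact hstep i i hi
  | h₁ i hi => exact ⟨1, i, hi, by rw [map_one, Perm.one_apply]⟩
  | h₂ i j hi _ => exact hstep i j hi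

end SimpleReflections

theorem mem_coweightLattice_iff_simple {x : N} :
    x ∈ coweightLattice P ↔ ∀ i ∈ b.support, ∃ k : ℤ, P.root' i x = k := by
  refine ⟨fun hx i _ => hx i, fun hx i => ?_⟩
  suffices h : ∀ m ∈ Submodule.span ℤ (P.root '' b.support),
      ∃ k : ℤ, P.toLinearMap m x = k from h _ (b.root_mem_span_int i)
  intro m hm
  induction hm using Submodule.span_induction with
  | mem m hm =>
    obtain ⟨i, hi, rfl⟩ := hm
    exact hx i hi
  | zero => exact ⟨0, by simp⟩
  | add m m' _ _ hm hm' =>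
    obtain ⟨k, hk⟩ := hm
    obtain ⟨k', hk'⟩ := hm'
    exact ⟨k + k', by rw [map_add, LinearMap.add_apply, hk, hk', Int.cast_add]⟩
  | smul a m _ hm =>
    obtain ⟨k, hk⟩ := hm
    exact ⟨a * k, by rw [map_zsmul, LinearMap.smul_apply, hk, zsmul_eq_mul, Int.cast_mul]⟩

variable [P.IsRootSystem]

/-- The values of the simple roots, as linear coordinates on the space of coweights. -/
def simpleRootCoords : N ≃ₗ[ℝ] (b.support → ℝ) :=
  P.toLinearMap.flip.toPerfPair ≪≫ₗ (b.toWeightBasis.constr ℝ).symm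

theorem simpleRootCoords_apply (x : N) (i : b.support) :
    simpleRootCoords b x i = P.root' i x := by
  have h := b.toWeightBasis.constr_basis ℝ (simpleRootCoords b x) i
  rw [b.toWeightBasis_apply] at h
  rw [← h]
  simp [simpleRootCoords]

/-- The coweight lattice is dual to the root lattice: its points are given by arbitrary integral
values of the simple roots. -/
def latticeEquiv : coweightLattice P ≃+ (b.support → ℤ) where
  toFun x i := integralRoot P i x
  invFun a := ⟨(simpleRootCoords b).symm fun i => a i,
    (mem_coweightLattice_iff_simple b).2 fun i hi => ⟨a ⟨i, hi⟩, by
      rw [← simpleRootCoords_apply b _ ⟨i, hi⟩, LinearEquiv.apply_symm_apply]⟩⟩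
  left_inv x := by
    ext
    simp [LinearEquiv.symm_apply_eq, funext_iff, simpleRootCoords_apply, intCast_integralRoot]
  right_inv a := by
    ext i
    simp [← Int.cast_inj (α := ℝ), intCast_integralRoot, ← simpleRootCoords_apply b]
  map_add' x y := by ext; simp

theorem eq_one_of_latticeAct_eq (b : P.Base) {w : P.weylGroup}
    (h : ∀ x, latticeAct P w x = x) : w = 1 := by
  classical
  have hbasis : ∀ i, (((latticeEquiv b).symm (Pi.single i 1) : coweightLattice P) : N) =
      Module.Basis.ofEquivFun (simpleRootCoords b) i := fun i => by
    rw [Module.Basis.coe_ofEquivFun]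
    change (simpleRootCoords b).symm _ = _
    congr 1
    ext j
    simp [Pi.single_apply]
  have hw : coweightAct P w = LinearEquiv.refl ℝ N := by
    refine (Module.Basis.ofEquivFun (simpleRootCoords b)).ext' fun i => ?_
    rw [← hbasis]
    exact congrArg Subtype.val (h _)
  refine Subtype.ext (inv_eq_one.1 (RootPairing.Equiv.coweightHom_injective P ?_))
  rw [map_one]
  exact MulOpposite.unop_injective hw

end CoweightLattice

section TypeACoordinates

theorem sub_eq_sub_of_succ_sub_eq {G : Type*} [AddCommGroup G] {n : ℕ} {f g : Fin (n + 1) → G}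
    (h : ∀ k : Fin n, f k.succ - f k.castSucc = g k.succ - g k.castSucc) (i j : Fin (n + 1)) :
    f i - f j = g i - g j := by
  have hbase : ∀ i, f i - g i = f 0 - g 0 := by
    intro i
    induction i using Fin.induction with
    | zero => rfl
    | succ k ih => rw [← ih, sub_eq_sub_iff_sub_eq_sub, h]
  rw [← sub_eq_sub_iff_sub_eq_sub, hbase i, hbase j]

variable {ι M N : Type*} [AddCommGroup M] [Module ℝ M] [AddCommGroup N] [Module ℝ N]
  {P : RootPairing ι ℝ M N} {b : P.Base} {l : ℕ} (e : Fin l ≃ b.support)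

/-- Coordinates on the coweight lattice in which `α_k` is the difference of the `k`-th and the
`(k - 1)`-st coordinate. The usual coordinates of type `A_l` are defined up to a common shift, which
is fixed here by requiring the `0`-th coordinate to vanish. -/
def coord : coweightLattice P →+ (Fin (l + 1) → ℤ) where
  toFun x := Fin.partialSum fun k => integralRoot P (e k) x
  map_zero' := by
    ext i
    induction i using Fin.induction with
    | zero => simp
    | succ k ih => simpa [Fin.partialSum_succ] using ih
  map_add' x y := by
    ext i
    induction i using Fin.induction with
    | zero => simp
    | succ k ih =>
      simp only [Fin.partialSum_succ, Pi.add_apply, map_add] at ih ⊢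
      rw [ih]
      abel

@[simp]
theorem coord_zero (x : coweightLattice P) : coord e x 0 = 0 :=
  Fin.partialSum_zero (fun k => integralRoot P (e k) x)

theorem coord_succ_sub_castSucc (x : coweightLattice P) (k : Fin l) :
    coord e x k.succ - coord e x k.castSucc = integralRoot P (e k) x :=
  sub_eq_iff_eq_add'.2 (Fin.partialSum_succ _ k)

/-- The Weyl group element `w` permutes the coordinates of coweights, taken up to a common shift,
according to `σ`. -/
def PermutesCoords (w : P.weylGroup) (σ : Perm (Fin (l + 1))) : Prop :=
  ∀ x i j, coord e (latticeAct P w x) (σ i) - coord e (latticeAct P w x) (σ j) =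
    coord e x i - coord e x j

variable {e}

namespace PermutesCoords

variable {v w : P.weylGroup} {σ τ : Perm (Fin (l + 1))}

variable (e) in
theorem one : PermutesCoords e 1 1 := fun x i j => by rw [latticeAct_one]; rfl

theorem mul (hv : PermutesCoords e v σ) (hw : PermutesCoords e w τ) :
    PermutesCoords e (v * w) (σ * τ) := fun x i j => by
  rw [latticeAct_mul, Perm.mul_apply, Perm.mul_apply, hv, hw]

theorem inv (hw : PermutesCoords e w σ) : PermutesCoords e w⁻¹ σ⁻¹ := fun x i j => by
  rw [← hw, ← latticeAct_mul, mul_inv_cancel, latticeAct_one, Perm.inv_def, apply_symm_apply,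
    apply_symm_apply]

theorem simple [P.IsCrystallographic] (hA : IsTypeA b e) (k : Fin l) :
    PermutesCoords e (RootPairing.weylGroup.ofIdx P (e k)) (adjSwap k) := by
  intro x i j
  have hpair : ∀ m, P.pairingIn ℤ (e m) (e k) = CartanMatrix.A l m k := fun m => by
    rw [← hA]
    rfl
  have hswap : ∀ i, coord e x (adjSwap k i) = coord e x i +
      ((if i = k.castSucc then 1 else 0) - (if i = k.succ then 1 else 0)) *
        integralRoot P (e k) x := fun i => by
    rw [← coord_succ_sub_castSucc, adjSwap, swap_apply_def]
    have := (Fin.castSucc_lt_succ (i := k)).ne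
    split_ifs <;> simp_all
  have hsub := sub_eq_sub_of_succ_sub_eq
    (f := coord e (latticeAct P (RootPairing.weylGroup.ofIdx P (e k)) x))
    (g := fun i => coord e x (adjSwap k i)) (fun m => by
      rw [coord_succ_sub_castSucc, integralRoot_latticeAct_ofIdx, hpair, hswap, hswap,
        ← coord_succ_sub_castSucc e x m]
      simp only [CartanMatrix.A, Matrix.of_apply, Fin.ext_iff, Fin.val_succ, Fin.val_castSucc]
      split_ifs <;> omega) (adjSwap k i) (adjSwap k j)
  simpa [adjSwap] using hsub

end PermutesCoords

theorem exists_permutesCoords [Finite ι] [P.IsCrystallographic] [P.IsReduced] (hA : IsTypeA b e)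
    (w : P.weylGroup) : ∃ σ, PermutesCoords e w σ := by
  have hw : w ∈ reflSubgroup P b.support := reflSubgroup_support b ▸ Subgroup.mem_top w
  induction hw using Subgroup.closure_induction with
  | mem _ h =>
    obtain ⟨i, hi, rfl⟩ := h
    obtain ⟨k, hk⟩ := e.surjective ⟨i, hi⟩
    have := PermutesCoords.simple hA k
    rw [hk] at this
    exact ⟨_, this⟩
  | one => exact ⟨1, .one e⟩
  | mul v w _ _ hv hw => exact ⟨_, hv.choose_spec.mul hw.choose_spec⟩
  | inv w _ hw => exact ⟨_, hw.choose_spec.inv⟩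

section RootSystem

variable [P.IsRootSystem]

variable (e) in
theorem exists_coord_eq {F : Fin (l + 1) → ℤ} (hF : F 0 = 0) : ∃ x, coord e x = F := by
  let x := (latticeEquiv b).symm fun i => F (e.symm i).succ - F (e.symm i).castSucc
  have hx : ∀ k, integralRoot P (e k) x = F k.succ - F k.castSucc := fun k => by
    have h := congrFun ((latticeEquiv b).apply_symm_apply fun i =>
      F (e.symm i).succ - F (e.symm i).castSucc) (e k)
    rwa [e.symm_apply_apply] at h
  refine ⟨x, funext fun i => ?_⟩
  have h := sub_eq_sub_of_succ_sub_eq (f := coord e x) (g := F)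
    (fun k => (coord_succ_sub_castSucc e x k).trans (hx k)) i 0
  rwa [coord_zero, hF, sub_zero, sub_zero] at h

variable (e) in
theorem coord_injective : Function.Injective (coord e) := fun x y h => by
  refine (latticeEquiv b).injective (funext fun i => ?_)
  obtain ⟨k, rfl⟩ := e.surjective i
  change integralRoot P (e k) x = integralRoot P (e k) y
  rw [← coord_succ_sub_castSucc, ← coord_succ_sub_castSucc, h]

theorem PermutesCoords.unique {w : P.weylGroup} {σ τ : Perm (Fin (l + 1))}
    (hσ : PermutesCoords e w σ) (hτ : PermutesCoords e w τ) : σ = τ := by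
  obtain ⟨x, hx⟩ := exists_coord_eq e (F := fun i => (i : ℤ)) rfl
  have h : PermutesCoords e 1 (σ⁻¹ * τ) := by simpa using hσ.inv.mul hτ
  refine (inv_mul_eq_one.1 (perm_eq_one_of_strictMono fun i j hij => ?_))
  have := h x i j
  simp only [latticeAct_one, hx] at this
  rw [Fin.lt_def] at hij ⊢
  omega

theorem PermutesCoords.eq_one {w : P.weylGroup} (h : PermutesCoords e w 1) : w = 1 :=
  eq_one_of_latticeAct_eq b fun x => coord_injective e <| funext fun i => by
    simpa using h x i 0

variable [Finite ι] [P.IsCrystallographic] [P.IsReduced]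

/-- The homomorphism from the Weyl group of type `A_l` to the symmetric group given by the action on
coordinates. -/
def permHom (hA : IsTypeA b e) : P.weylGroup →* Perm (Fin (l + 1)) :=
  MonoidHom.mk' (fun w => (exists_permutesCoords hA w).choose) fun v w =>
    (exists_permutesCoords hA (v * w)).choose_spec.unique
      ((exists_permutesCoords hA v).choose_spec.mul (exists_permutesCoords hA w).choose_spec)

theorem permutesCoords_permHom (hA : IsTypeA b e) (w : P.weylGroup) :
    PermutesCoords e w (permHom hA w) :=
  (exists_permutesCoords hA w).choose_spec

theorem permHom_injective (hA : IsTypeA b e) : Function.Injective (permHom hA) :=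
  (injective_iff_map_eq_one _).2 fun w hw =>
    PermutesCoords.eq_one (hw ▸ permutesCoords_permHom hA w)

theorem permHom_simple (hA : IsTypeA b e) (k : Fin l) :
    permHom hA (RootPairing.weylGroup.ofIdx P (e k)) = adjSwap k :=
  (permutesCoords_permHom hA _).unique (.simple hA k)

theorem permHom_surjective (hA : IsTypeA b e) : Function.Surjective (permHom hA) := by
  rw [← MonoidHom.mrange_eq_top, ← top_le_iff, ← Perm.mclosure_swap_castSucc_succ,
    Submonoid.closure_le]
  rintro _ ⟨k, rfl⟩
  exact ⟨_, permHom_simple hA k⟩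

theorem integralRoot_eq_coord_sub (hA : IsTypeA b e) (w : P.weylGroup) (k : Fin l)
    (x : coweightLattice P) :
    integralRoot P (P.weylGroupToPerm w (e k)) x =
      coord e x (permHom hA w k.succ) - coord e x (permHom hA w k.castSucc) := by
  have h := permutesCoords_permHom hA w (latticeAct P w⁻¹ x) k.succ k.castSucc
  rw [coord_succ_sub_castSucc, integralRoot_latticeAct, inv_inv, ← latticeAct_mul, mul_inv_cancel,
    latticeAct_one] at h
  exact h.symm

theorem exists_integralRoot_eq_coord_sub (hA : IsTypeA b e) (i : ι) :
    ∃ a c, a ≠ c ∧ ∀ x, integralRoot P i x = coord e x a - coord e x c := by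
  obtain ⟨w, _, hj, rfl⟩ := exists_weylGroupToPerm_simple_eq b i
  obtain ⟨k, hk⟩ := e.surjective ⟨_, hj⟩
  refine ⟨permHom hA w k.succ, permHom hA w k.castSucc,
    (permHom hA w).injective.ne Fin.castSucc_lt_succ.ne', fun x => ?_⟩
  rw [← integralRoot_eq_coord_sub, hk]

theorem exists_coord_sub_eq_integralRoot (hA : IsTypeA b e) {a c : Fin (l + 1)} (hac : a ≠ c) :
    ∃ i, ∀ x, coord e x a - coord e x c = integralRoot P i x := by
  cases l with
  | zero => exact absurd (Subsingleton.elim (α := Fin 1) a c) hac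
  | succ l =>
    have := Perm.isMultiplyPretransitive (Fin (l + 2)) 2
    obtain ⟨σ, hσa, hσc⟩ := is_two_pretransitive_iff.1 this
      (Fin.castSucc_lt_succ (i := (0 : Fin (l + 1)))).ne' hac
    obtain ⟨w, rfl⟩ := permHom_surjective hA σ
    exact ⟨_, fun x => by rw [integralRoot_eq_coord_sub hA w 0, ← hσa, ← hσc]; rfl⟩

end RootSystem

section LongestElements

variable (e) in
/-- The indices of the simple roots `α_k` with `k ≠ m`. For `m = 0` these are all simple roots. -/
def simplesAway (m : Fin (l + 1)) : Set ι := (fun k => (e k : ι)) '' {k | k.succ ≠ m}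

theorem simplesAway_zero : simplesAway e 0 = b.support := by
  ext i
  simp only [simplesAway, ne_eq, Fin.succ_ne_zero, not_false_eq_true, Set.mem_image]
  exact ⟨fun ⟨k, _, hk⟩ => hk ▸ (e k).2, fun hi => ⟨e.symm ⟨i, hi⟩, trivial, by simp⟩⟩

theorem simplesAway_succ (k : Fin l) :
    simplesAway e k.succ = (b.support : Set ι) \ {(e k : ι)} := by
  have hinj : Function.Injective fun k => (e k : ι) := Subtype.val_injective.comp e.injective
  rw [← simplesAway_zero (e := e), ← Set.image_singleton (f := fun k => (e k : ι)), simplesAway,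
    simplesAway, ← Set.image_sdiff hinj]
  congr 1
  ext i
  simp [Fin.succ_ne_zero]

variable [Finite ι] [P.IsCrystallographic] [P.IsReduced] [P.IsRootSystem]

theorem permHom_mem_stabilizer_Iio (hA : IsTypeA b e) {m : Fin (l + 1)} {w : P.weylGroup}
    (hw : w ∈ reflSubgroup P (simplesAway e m)) :
    permHom hA w ∈ stabilizer (Perm (Fin (l + 1))) (Set.Iio m) := by
  suffices h : reflSubgroup P (simplesAway e m) ≤
    (stabilizer (Perm (Fin (l + 1))) (Set.Iio m)).comap (permHom hA) from h hw
  rw [reflSubgroup, Subgroup.closure_le]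
  rintro _ ⟨_, ⟨k, hk, rfl⟩, rfl⟩
  rw [SetLike.mem_coe, Subgroup.mem_comap, permHom_simple]
  exact adjSwap_mem_stabilizer_Iio hk

theorem permHom_list_prod (hA : IsTypeA b e) (L : List (Fin l)) :
    permHom hA ((L.map fun k => (e k : ι)).map (RootPairing.weylGroup.ofIdx P)).prod =
      (L.map adjSwap).prod := by
  rw [map_list_prod, List.map_map, List.map_map]
  exact congrArg _ (List.map_congr_left fun k _ => permHom_simple hA k)

theorem reflLength_simplesAway (hA : IsTypeA b e) {m : Fin (l + 1)} {w : P.weylGroup}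
    (hw : w ∈ reflSubgroup P (simplesAway e m)) :
    reflLength P (simplesAway e m) w = (inversions (permHom hA w)).card := by
  obtain ⟨L, hL, hlen, hprod⟩ := exists_list_adjSwap_prod (permHom_mem_stabilizer_Iio hA hw)
  refine IsLeast.csInf_eq ⟨⟨L.map fun k => (e k : ι), ?_, by simpa using hlen, ?_⟩, ?_⟩
  · simpa [simplesAway] using hL
  · exact permHom_injective hA ((permHom_list_prod hA L).trans hprod)
  · rintro _ ⟨L', hL', rfl, rfl⟩
    obtain ⟨L'', rfl⟩ : L' ∈ Set.range (List.map fun k => (e k : ι)) := by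
      rw [Set.range_list_map]
      exact fun i hi => Set.image_subset_range _ _ (hL' i hi)
    rw [permHom_list_prod, List.length_map]
    exact card_inversions_list_prod_le L''

theorem IsLongest.permHom_eq (hA : IsTypeA b e) {m : Fin (l + 1)} {w : P.weylGroup}
    (hw : IsLongest P (simplesAway e m) w) : permHom hA w = Equiv.subLeft (m - 1) := by
  refine eq_subLeft_of_mem_stabilizer_Iio (permHom_mem_stabilizer_Iio hA hw.1) fun k hk => ?_
  by_contra hlt
  have hasc : permHom hA w k.castSucc < permHom hA w k.succ :=
    (not_lt.1 hlt).lt_of_ne ((permHom hA w).injective.ne Fin.castSucc_lt_succ.ne)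
  have hmem : w * RootPairing.weylGroup.ofIdx P (e k) ∈ reflSubgroup P (simplesAway e m) :=
    mul_mem hw.1 (Subgroup.subset_closure ⟨_, ⟨k, hk, rfl⟩, rfl⟩)
  have hlen := hw.2 _ hmem
  rw [reflLength_simplesAway hA hmem, reflLength_simplesAway hA hw.1, map_mul, permHom_simple,
    adjSwap, card_inversions_mul_swap_of_lt (castSucc_covBy_succ k) hasc] at hlen
  exact Nat.not_succ_le_self _ hlen

theorem permHom_longest (hA : IsTypeA b e) (m : Fin (l + 1)) :
    permHom hA (longest P (simplesAway e m)) = Equiv.subLeft (m - 1) :=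
  IsLongest.permHom_eq hA (exists_isLongest P _).choose_spec

theorem permHom_omega (hA : IsTypeA b e) (j : Fin (l + 1)) :
    permHom hA (omega b e j) = Equiv.addRight j := by
  cases j using Fin.cases with
  | zero => ext; simp [omega]
  | succ k =>
    rw [omega, Fin.cases_succ, ← simplesAway_succ, ← simplesAway_zero (e := e), map_mul,
      permHom_longest, permHom_longest]
    ext i
    congr 1
    simp only [Perm.mul_apply, subLeft_apply, coe_addRight]
    abel

theorem orderOf_omega (hA : IsTypeA b e) (j : Fin (l + 1)) :
    orderOf (omega b e j) = addOrderOf j := by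
  rw [← orderOf_injective _ (permHom_injective hA), permHom_omega, orderOf_addRight]

end LongestElements

section Residues

variable {q : ℕ}

variable (e q) in
/-- The coordinates of a coweight modulo `q`. -/
def residues : coweightLattice P →+ (Fin (l + 1) → ZMod q) :=
  ((Int.castAddHom (ZMod q)).compLeft _).comp (coord e)

theorem residues_apply (x : coweightLattice P) (i : Fin (l + 1)) :
    residues e q x i = (coord e x i : ZMod q) := rfl

@[simp]
theorem residues_zero (x : coweightLattice P) : residues e q x 0 = 0 := by
  rw [residues_apply, coord_zero, Int.cast_zero]

theorem residues_eq_iff_dvd (x : coweightLattice P) (a c : Fin (l + 1)) :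
    residues e q x a = residues e q x c ↔ (q : ℤ) ∣ coord e x c - coord e x a :=
  ZMod.intCast_eq_intCast_iff_dvd_sub _ _ q

theorem PermutesCoords.residues_latticeAct {w : P.weylGroup} {σ : Perm (Fin (l + 1))}
    (h : PermutesCoords e w σ) (x : coweightLattice P) (i : Fin (l + 1)) :
    residues e q (latticeAct P w x) (σ i) =
      residues e q x i + residues e q (latticeAct P w x) (σ 0) := by
  have hcast := congrArg (Int.cast : ℤ → ZMod q) (h x i 0)
  rw [coord_zero, sub_zero, Int.cast_sub] at hcast
  exact eq_add_of_sub_eq hcast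

variable [P.IsRootSystem]

variable (e q) in
theorem ker_residues : (residues e q).ker = multiples P q := by
  ext x
  constructor
  · intro hx
    have hdvd : ∀ i, (q : ℤ) ∣ coord e x i := fun i =>
      (ZMod.intCast_zmod_eq_zero_iff_dvd _ q).1 (congrFun hx i)
    obtain ⟨y, hy⟩ := exists_coord_eq e (F := fun i => coord e x i / q) (by simp)
    refine ⟨y, coord_injective e (funext fun i => ?_)⟩
    simp [hy, Int.mul_ediv_cancel' (hdvd i)]
  · rintro ⟨y, rfl⟩
    ext i
    simp

theorem mk_eq_mk_iff_residues_eq (x y : coweightLattice P) :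
    (QuotientAddGroup.mk x : LatticeMod P q) = QuotientAddGroup.mk y ↔
      residues e q x = residues e q y := by
  rw [QuotientAddGroup.eq_iff_sub_mem, ← ker_residues e q, AddMonoidHom.mem_ker, map_sub,
    sub_eq_zero]

variable (e) in
theorem exists_residues_eq {F : Fin (l + 1) → ZMod q} (hF : F 0 = 0) :
    ∃ x, residues e q x = F := by
  choose a ha using fun i => ZMod.intCast_surjective (F i)
  obtain ⟨x, hx⟩ := exists_coord_eq e (F := fun i => a i - a 0) (sub_self _)
  refine ⟨x, funext fun i => ?_⟩
  rw [residues_apply, hx, Int.cast_sub, ha, ha, hF, sub_zero]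

variable (e q) in
/-- Residue vectors of length `l + 1` are elements of `Z / qZ` together with a common shift, which
accounts for the normalization of `coord`. -/
def latticeModProdEquiv : LatticeMod P q × ZMod q ≃ (Fin (l + 1) → ZMod q) :=
  Equiv.ofBijective
    (fun p i => QuotientAddGroup.lift _ (residues e q) (ker_residues e q).ge p.1 i + p.2) <| by
    constructor
    · rintro ⟨⟨x⟩, u⟩ ⟨⟨y⟩, v⟩ h
      have hxy : ∀ i, residues e q x i + u = residues e q y i + v := congrFun h
      obtain rfl : u = v := by simpa using hxy 0
      have hres : residues e q x = residues e q y := funext fun i => add_right_cancel (hxy i)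
      exact Prod.ext ((mk_eq_mk_iff_residues_eq x y).2 hres) rfl
    · intro F
      obtain ⟨x, hx⟩ := exists_residues_eq e (F := fun i => F i - F 0) (sub_self _)
      exact ⟨(QuotientAddGroup.mk x, F 0), funext fun i => by simp [hx]⟩

theorem finite_latticeMod (e : Fin l ≃ b.support) (q : ℕ) [NeZero q] : Finite (LatticeMod P q) :=
  .of_injective (fun t => latticeModProdEquiv e q (t, 0)) <|
    (latticeModProdEquiv e q).injective.comp (Prod.mk_left_injective 0)

variable [Finite ι] [P.IsCrystallographic] [P.IsReduced]

theorem mk_mem_complement_iff_injective (hA : IsTypeA b e) (x : coweightLattice P) :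
    (QuotientAddGroup.mk x : LatticeMod P q) ∈ complement P q ↔
      Function.Injective (residues e q x) := by
  rw [mk_mem_complement_iff]
  constructor
  · intro hx a c hac
    by_contra hne
    obtain ⟨i, hi⟩ := exists_coord_sub_eq_integralRoot hA (Ne.symm hne)
    exact hx i (hi x ▸ (residues_eq_iff_dvd x a c).1 hac)
  · intro hinj i hi
    obtain ⟨a, c, hac, h⟩ := exists_integralRoot_eq_coord_sub hA i
    exact hac (hinj ((residues_eq_iff_dvd x c a).2 (h x ▸ hi))).symm

theorem modAct_mk_eq_iff (hA : IsTypeA b e) (w : P.weylGroup) (x : coweightLattice P) :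
    modAct P q w (QuotientAddGroup.mk x) = QuotientAddGroup.mk x ↔
      ∃ c, ∀ i, residues e q x (permHom hA w i) = residues e q x i + c := by
  have hact := (permutesCoords_permHom hA w).residues_latticeAct (q := q) x
  change (QuotientAddGroup.mk (latticeAct P w x) : LatticeMod P q) = _ ↔ _
  rw [mk_eq_mk_iff_residues_eq (e := e)]
  constructor
  · intro h
    exact ⟨_, fun i => h ▸ hact i⟩
  · rintro ⟨c, hc⟩
    have hshift : c = residues e q (latticeAct P w x) (permHom hA w 0) := by
      refine add_left_cancel (a := residues e q x ((permHom hA w).symm 0)) ?_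
      rw [← hc, ← hact, apply_symm_apply, residues_zero, residues_zero]
    ext i
    obtain ⟨i, rfl⟩ := (permHom hA w).surjective i
    rw [hact, hc, hshift]

theorem card_fixed_mul (hA : IsTypeA b e) (w : P.weylGroup) :
    Nat.card {t : complement P q // w • t = t} * q =
      Nat.card {F : Fin (l + 1) → ZMod q //
        Function.Injective F ∧ ∃ c, ∀ i, F (permHom hA w i) = F i + c} := by
  let fixedEquiv : {t : complement P q // w • t = t} ≃
      {t : LatticeMod P q // t ∈ complement P q ∧ modAct P q w t = t} :=
    (Equiv.subtypeEquivRight fun _ => Subtype.ext_iff).trans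
      (Equiv.subtypeSubtypeEquivSubtypeInter _ fun t => modAct P q w t = t)
  have hfixed : ∀ p : LatticeMod P q × ZMod q,
      p.1 ∈ complement P q ∧ modAct P q w p.1 = p.1 ↔
        Function.Injective (latticeModProdEquiv e q p) ∧ ∃ c, ∀ i,
          latticeModProdEquiv e q p (permHom hA w i) = latticeModProdEquiv e q p i + c := by
    rintro ⟨⟨x⟩, u⟩
    refine and_congr ((mk_mem_complement_iff_injective hA x).trans
      ((add_left_injective u).of_comp_iff _).symm) ((modAct_mk_eq_iff hA w x).trans
        (exists_congr fun c => forall_congr' fun i => ?_))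
    change _ ↔ residues e q x _ + u = residues e q x i + u + c
    rw [add_right_comm, add_left_inj]
  calc Nat.card {t : complement P q // w • t = t} * q
      = Nat.card ({t : LatticeMod P q // t ∈ complement P q ∧ modAct P q w t = t} × ZMod q) := by
        rw [Nat.card_prod, Nat.card_zmod, Nat.card_congr fixedEquiv]
    _ = Nat.card {p : LatticeMod P q × ZMod q // p.1 ∈ complement P q ∧ modAct P q w p.1 = p.1} :=
        Nat.card_congr Equiv.prodSubtypeFstEquivSubtypeProd.symm
    _ = _ := Nat.card_congr ((latticeModProdEquiv e q).subtypeEquiv hfixed)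

theorem equivChar_mul [NeZero q] (hA : IsTypeA b e) (w : P.weylGroup) :
    equivChar P q w * q = Nat.card {F : Fin (l + 1) → ZMod q //
        Function.Injective F ∧ ∃ c, ∀ i, F (permHom hA w i) = F i + c} := by
  have := finite_latticeMod e q
  rw [equivChar, character_ofMulAction, ← card_fixed_mul, Nat.cast_mul]

end Residues

end TypeACoordinates

theorem card_fin_div_addOrderOf {l : ℕ} (j : Fin (l + 1)) :
    Nat.card (Fin (l + 1)) / addOrderOf j = Nat.gcd (l + 1) j := by
  have h := ZMod.addOrderOf_coe (j : ℕ) (Nat.succ_ne_zero l)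
  rw [show ((j : ℕ) : ZMod (l + 1)) = j from Fin.cast_val_eq_self j] at h
  rw [Nat.card_fin, show addOrderOf j = _ from h,
    Nat.div_div_self (Nat.gcd_dvd_left _ _) (Nat.succ_ne_zero l)]

theorem cast_descFactorial_div_mul_pow {R : Type*} [CommRing R] {q d g : ℕ} (hd : d ∣ q)
    (hg : 0 < g) (hd0 : 0 < d) :
    (((q / d).descFactorial g * d ^ g : ℕ) : R) =
      (∏ k ∈ Finset.Ico 1 g, ((q : R) - (d : R) * (k : R))) * q := by
  obtain ⟨m, rfl⟩ := hd
  have hprod : (d : R) ^ g * ∏ k ∈ Finset.range g, ((m : R) - k) =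
      ∏ k ∈ Finset.range g, (((d * m : ℕ) : R) - (d : R) * (k : R)) := by
    simpa [mul_sub] using Finset.pow_card_mul_prod (s := Finset.range g) (b := (d : R))
      (f := fun k : ℕ => (m : R) - k)
  rw [Nat.mul_div_cancel_left _ hd0, Nat.cast_mul, Nat.cast_pow,
    ← descPochhammer_eval_eq_descFactorial, descPochhammer_eval_eq_prod_range, mul_comm, hprod,
    Finset.prod_range_eq_mul_Ico _ hg, Nat.cast_zero, mul_zero, sub_zero, mul_comm]

end EquivariantQuasi

end

theorem mainTheorem5 {ι M N : Type*} [Finite ι] [AddCommGroup M] [Module ℝ M]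
    [AddCommGroup N] [Module ℝ N] (P : RootPairing ι ℝ M N) [P.IsRootSystem]
    [P.IsCrystallographic] [P.IsReduced] (b : P.Base) (l : ℕ) (e : Fin l ≃ b.support)
    (hA : EquivariantQuasi.IsTypeA b e) (j : Fin (l + 1)) (g d : ℕ)
    (hg : g = Nat.gcd (l + 1) (j : ℕ)) (hd : d = orderOf (EquivariantQuasi.omega b e j))
    (q : ℕ) (hq : 0 < q) :
    (¬ d ∣ q → EquivariantQuasi.equivChar P q (EquivariantQuasi.omega b e j) = 0) ∧
    (d ∣ q → EquivariantQuasi.equivChar P q (EquivariantQuasi.omega b e j) =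
      (Nat.totient d : ℂ) * ∏ k ∈ Finset.Ico 1 g, ((q : ℂ) - (d : ℂ) * (k : ℂ))) := by
  have : NeZero q := ⟨hq.ne'⟩
  have hq_ne : (q : ℂ) ≠ 0 := Nat.cast_ne_zero.2 hq.ne'
  rw [EquivariantQuasi.orderOf_omega hA] at hd
  have hd_pos : 0 < d := hd ▸ addOrderOf_pos j
  have hg_pos : 0 < g := hg ▸ Nat.gcd_pos_of_pos_left _ l.succ_pos
  have hcard : Nat.card (Fin (l + 1)) / d = g := by
    rw [hd, hg, EquivariantQuasi.card_fin_div_addOrderOf]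
  have hchar := EquivariantQuasi.equivChar_mul (q := q) hA (EquivariantQuasi.omega b e j)
  simp only [EquivariantQuasi.permHom_omega, Equiv.coe_addRight,
    EquivariantQuasi.card_injective_intertwining_translation, Nat.card_zmod, ← hd, hcard] at hchar
  refine ⟨fun hdq => ?_, fun hdq => mul_right_cancel₀ hq_ne ?_⟩
  · rw [if_neg hdq, Nat.cast_zero] at hchar
    exact (mul_eq_zero.1 hchar).resolve_right hq_ne
  · rw [hchar, if_pos hdq, Nat.cast_mul,
      EquivariantQuasi.cast_descFactorial_div_mul_pow hdq hg_pos hd_pos, mul_assoc]
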